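/- Let $\mathbf N(\cdot;\theta):\mathbb R^\ell\to\mathbb R^d$ be a family of neural network maps of a fixed architecture, indexed by the parameter $\theta$. For a given training data set $D$ and a chosen stochastic optimization algorithm with settings $\mathcal S$, let $\mathcal D_\Theta$ be the probability distribution of the parameter $\Theta$ produced by one training. For each $K\ge 1$ let $\Theta^{(1)},\dots,\Theta^{(K)}$ be the parameters obtained from $K$ independent trainings, so that they are i.i.d. with law $\mathcal D_\Theta$. Put $\mathbf N^{(i)}=\mathbf N(\cdot;\Theta^{(i)})$ and let $$\mathbf N^{(A)}(\cdot)=\frac1K\sum_{i=1}^K\mathbf N^{(i)}(\cdot)$$ be the ensemble-averaged network. Fix an input $\mathbf x\in\mathbb R^\ell$, assume that $\mathbf N(\mathbf x;\Theta)$ with $\Theta\sim\mathcal D_\Theta$ has a finite second moment, $\mathbb E\|\mathbf N(\mathbf x;\Theta)\|^2<\infty$, and let $$\boldsymbol\nu(\mathbf x)=\mathbb E[\mathbf N(\mathbf x;\Theta)],\qquad \boldsymbol\Sigma(\mathbf x)=\operatorname{Cov}(\mathbf N(\mathbf x;\Theta)).$$ Then $$\sqrt K\,\bigl(\mathbf N^{(A)}(\mathbf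 x)-\boldsymbol\nu(\mathbf x)\bigr)\;\longrightarrow\;\mathcal N_d\bigl(\mathbf 0,\boldsymbol\Sigma(\mathbf x)\bigr)\qquad (K\to\infty)$$ in distribution, where $\mathcal N_d(\mathbf 0,\boldsymbol\Sigma(\mathbf x))$ is the (possibly degenerate) $d$-variate normal distribution with mean zero and covariance matrix $\boldsymbol\Sigma(\mathbf x)$. -/

import Mathlib

open MeasureTheory ProbabilityTheory Filter

noncomputable section

namespace EnsembleAveraging

variable {X Par : Type*} {d : ℕ}

/-- Mean `ν(x) = E[N(x; Θ)]` of the network output at the input `x`, where the parameters `Θ` are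
distributed according to `DΘ`. -/
def outputMean [MeasurableSpace Par] (N : X → Par → EuclideanSpace ℝ (Fin d)) (DΘ : Measure Par)
    (x : X) : EuclideanSpace ℝ (Fin d) :=
  ∫ θ, N x θ ∂DΘ

/-- Covariance matrix `Σ(x) = Cov(N(x; Θ))` of the network output at the input `x`, where the
parameters `Θ` are distributed according to `DΘ`. -/
def outputCov [MeasurableSpace Par] (N : X → Par → EuclideanSpace ℝ (Fin d)) (DΘ : Measure Par)
    (x : X) : Matrix (Fin d) (Fin d) ℝ :=
  Matrix.of fun i j => cov[fun θ => N x θ i, fun θ => N x θ j; DΘ]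

/-- The ensemble-averaged network `N^{(A)} = (1/K) ∑ᵢ N(·; θᵢ)` with parameters `θ₁, …, θ_K`. -/
def ensembleAverage (N : X → Par → EuclideanSpace ℝ (Fin d)) {K : ℕ} (θ : Fin K → Par) (x : X) :
    EuclideanSpace ℝ (Fin d) :=
  (1 / (K : ℝ)) • ∑ i, N x (θ i)

end EnsembleAveraging

end

/-!
Convergence in distribution only depends on the laws of the variables involved, so the rows
`Θ K 0, …, Θ K (K - 1)` may be replaced by the initial segments of one i.i.d. sequence. By the
Cramér–Wold device it then suffices to study the projections on a fixed vector `t`; these are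
i.i.d. real variables with variance `tᵀ Σ(x) t`, to which the one-dimensional central limit theorem
applies.
-/

open scoped RealInnerProductSpace

section ConvergenceInDistribution

variable {Ω' : Type*} [MeasurableSpace Ω'] {P' : Measure Ω'}

lemma tendstoInDistribution_of_forall_identDistrib [IsProbabilityMeasure P']
    {ι E : Type*} {Ω₁ Ω₂ : ι → Type*}
    [∀ i, MeasurableSpace (Ω₁ i)] {P₁ : (i : ι) → Measure (Ω₁ i)} [∀ i, IsProbabilityMeasure (P₁ i)]
    [∀ i, MeasurableSpace (Ω₂ i)] {P₂ : (i : ι) → Measure (Ω₂ i)} [∀ i, IsProbabilityMeasure (P₂ i)]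
    [TopologicalSpace E] [MeasurableSpace E] [OpensMeasurableSpace E]
    {X : (i : ι) → Ω₁ i → E} {Y : (i : ι) → Ω₂ i → E} {Z : Ω' → E} {l : Filter ι}
    (hX : TendstoInDistribution X l Z P₁ P')
    (hXY : ∀ i, IdentDistrib (X i) (Y i) (P₁ i) (P₂ i)) :
    TendstoInDistribution Y l Z P₂ P' where
  forall_aemeasurable i := (hXY i).aemeasurable_snd
  aemeasurable_limit := hX.aemeasurable_limit
  tendsto := by simpa only [(hXY _).map_eq] using hX.tendsto

variable {E : Type*} [NormedAddCommGroup E] [InnerProductSpace ℝ E] [MeasurableSpace E]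
  [BorelSpace E]

lemma charFun_map_inner_one {Y : Ω' → E} (hY : AEMeasurable Y P')
    (t : E) : charFun (P'.map fun ω => ⟪t, Y ω⟫) 1 = charFun (P'.map Y) t := by
  rw [charFun_eq_charFunDual_toDualMap t, charFunDual_eq_charFun_map_one,
    AEMeasurable.map_map_of_aemeasurable (by fun_prop) hY]
  rfl

variable [FiniteDimensional ℝ E]

/-- The **Cramér–Wold device**. -/
theorem tendstoInDistribution_iff_forall_inner [IsProbabilityMeasure P'] {Ω : ℕ → Type*}
    [∀ n, MeasurableSpace (Ω n)] {P : (n : ℕ) → Measure (Ω n)} [∀ n, IsProbabilityMeasure (P n)]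
    {X : (n : ℕ) → Ω n → E} {Z : Ω' → E} (hX : ∀ n, AEMeasurable (X n) (P n))
    (hZ : AEMeasurable Z P') :
    TendstoInDistribution X atTop Z P P' ↔
      ∀ t, TendstoInDistribution (fun n ω => ⟪t, X n ω⟫) atTop (fun ω => ⟪t, Z ω⟫) P P' := by
  refine ⟨fun h t => h.continuous_comp (g := fun y => ⟪t, y⟫) (by fun_prop), fun h => ⟨hX, hZ, ?_⟩⟩
  refine ProbabilityMeasure.tendsto_iff_tendsto_charFun.2 fun t => ?_
  have hone := ProbabilityMeasure.tendsto_iff_tendsto_charFun.1 (h t).tendsto 1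
  simpa only [ProbabilityMeasure.coe_mk, charFun_map_inner_one (hX _),
    charFun_map_inner_one hZ] using hone

end ConvergenceInDistribution

section CentralLimitTheorem

variable {E : Type*} [NormedAddCommGroup E] [InnerProductSpace ℝ E]
  [MeasurableSpace E] [BorelSpace E] {μ γ : Measure E} [IsGaussian γ]
  {Ω' : Type*} [MeasurableSpace Ω'] {P' : Measure Ω'} {Z : Ω' → E}

lemma hasLaw_inner_of_isGaussian [CompleteSpace E] [SecondCountableTopology E] (hZ : HasLaw Z γ P')
    (t : E) :
    HasLaw (fun ω => ⟪t, Z ω⟫) (gaussianReal ⟪t, γ[id]⟫ (covarianceBilin γ t t).toNNReal) P' := by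
  refine HasLaw.fun_comp (Y := fun y => ⟪t, y⟫) ⟨by fun_prop, ?_⟩ hZ
  rw [covarianceBilin_self IsGaussian.memLp_two_id, ← integral_inner IsGaussian.integrable_id]
  exact IsGaussian.map_eq_gaussianReal (innerSL ℝ t)

variable [FiniteDimensional ℝ E] [IsProbabilityMeasure P']

theorem tendstoInDistribution_inv_sqrt_smul_sum_sub {Ω : Type*} [MeasurableSpace Ω] {P : Measure Ω}
    [IsProbabilityMeasure P] {X : ℕ → Ω → E} (hμ : MemLp id 2 μ) (hγ : γ[id] = 0)
    (hcov : covarianceBilin γ = covarianceBilin μ) (hZ : HasLaw Z γ P')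
    (hlaw : ∀ k, HasLaw (X k) μ P) (hindep : iIndepFun X P) :
    TendstoInDistribution
      (fun (n : ℕ) ω => (√n)⁻¹ • (∑ k ∈ Finset.range n, X k ω - (n : ℝ) • μ[id]))
      atTop Z (fun _ => P) P' := by
  have : IsProbabilityMeasure μ := (hlaw 0).isProbabilityMeasure_iff.1 inferInstance
  refine (tendstoInDistribution_iff_forall_inner (fun n => ?_) hZ.aemeasurable).2 fun t => ?_
  · have hsum := Finset.aemeasurable_fun_sum (Finset.range n) fun k _ => (hlaw k).aemeasurable
    exact (hsum.sub_const _).const_smul _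
  have hproj k : HasLaw (fun ω => ⟪t, X k ω⟫) (μ.map fun y => ⟪t, y⟫) P :=
    HasLaw.fun_comp (Y := fun y => ⟪t, y⟫) ⟨by fun_prop, rfl⟩ (hlaw k)
  have hmean : P[fun ω => ⟪t, X 0 ω⟫] = ⟪t, μ[id]⟫ := by
    rw [← integral_inner (hμ.integrable one_le_two)]
    exact (hlaw 0).integral_comp (f := fun y => ⟪t, y⟫) (by fun_prop)
  have hvar : Var[fun ω => ⟪t, X 0 ω⟫; P] = covarianceBilin γ t t := by
    rw [hcov, covarianceBilin_self hμ, ← (hlaw 0).map_eq, variance_map (by fun_prop)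
      (hlaw 0).aemeasurable]
    rfl
  have hlim : HasLaw (fun ω => ⟪t, Z ω⟫)
      (gaussianReal 0 Var[fun ω => ⟪t, X 0 ω⟫; P].toNNReal) P' := by
    simpa only [hγ, inner_zero_right, hvar] using hasLaw_inner_of_isGaussian hZ t
  have hmem : MemLp (fun ω => ⟪t, X 0 ω⟫) 2 P := by
    rw [← (hlaw 0).map_eq, memLp_map_measure_iff (by fun_prop) (hlaw 0).aemeasurable] at hμ
    exact hμ.const_inner t
  have hproj_indep : iIndepFun (fun k ω => ⟪t, X k ω⟫) P :=
    hindep.comp (fun _ y => ⟪t, y⟫) fun _ => by fun_prop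
  simpa only [inner_smul_right, inner_sub_right, inner_sum, hmean] using
    ProbabilityTheory.tendstoInDistribution_inv_sqrt_mul_sum_sub (X := fun k ω => ⟪t, X k ω⟫)
      hlim hmem hproj_indep fun k => (hproj k).identDistrib (hproj 0)

theorem tendstoInDistribution_inv_sqrt_smul_sum_sub_of_rows {Ω : ℕ → Type*}
    [∀ n, MeasurableSpace (Ω n)] {P : (n : ℕ) → Measure (Ω n)} [∀ n, IsProbabilityMeasure (P n)]
    {Y : (n : ℕ) → Fin n → Ω n → E} (hμ : MemLp id 2 μ) (hγ : γ[id] = 0)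
    (hcov : covarianceBilin γ = covarianceBilin μ) (hZ : HasLaw Z γ P')
    (hlaw : ∀ n i, HasLaw (Y n i) μ (P n)) (hindep : ∀ n, iIndepFun (Y n) (P n)) :
    TendstoInDistribution (fun (n : ℕ) ω => (√n)⁻¹ • (∑ i, Y n i ω - (n : ℝ) • μ[id]))
      atTop Z P P' := by
  have : IsProbabilityMeasure μ := (hlaw 1 0).isProbabilityMeasure_iff.1 inferInstance
  obtain ⟨Ω₀, _, P₀, X, -, hXlaw, hXindep, _⟩ := exists_iid ℕ μ
  refine tendstoInDistribution_of_forall_identDistrib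
    (tendstoInDistribution_inv_sqrt_smul_sum_sub hμ hγ hcov hZ hXlaw hXindep) fun n => ?_
  have hrow : IdentDistrib (fun ω (i : Fin n) => X i ω) (fun ω i => Y n i ω) P₀ (P n) :=
    .pi (fun i => (hXlaw i).identDistrib (hlaw n i))
      (hXindep.precomp Fin.val_injective) (hindep n)
  simpa only [Finset.sum_range, Function.comp_def] using
    hrow.comp (u := fun y => (√n)⁻¹ • (∑ i, y i - (n : ℝ) • μ[id])) (by fun_prop)

end CentralLimitTheorem

section CovarianceMatrix

variable {Ω ι : Type*} [MeasurableSpace Ω] {P : Measure Ω} {Y : Ω → EuclideanSpace ℝ ι}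

/-- The covariance matrix of a random vector `Y` under `P`. The matrix `Σ(x)` is that of the output
`N x` under the law of the parameters. -/
noncomputable def covarianceMatrix (Y : Ω → EuclideanSpace ℝ ι) (P : Measure Ω) : Matrix ι ι ℝ :=
  Matrix.of fun i j => cov[fun ω => Y ω i, fun ω => Y ω j; P]

variable [Fintype ι] [IsFiniteMeasure P]

lemma covarianceBilin_map_eq_dotProduct_mulVec (hY : MemLp Y 2 P) (u v : EuclideanSpace ℝ ι) :
    covarianceBilin (P.map Y) u v = u ⬝ᵥ (covarianceMatrix Y P).mulVec v := by
  have hcoord i : MemLp (fun ω => Y ω i) 2 P :=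
    hY.continuousLinearMap_comp (EuclideanSpace.proj (𝕜 := ℝ) i)
  have h := covarianceBilin_apply_pi hcoord u v
  simp only [WithLp.toLp_ofLp] at h
  simp only [h, dotProduct, Matrix.mulVec, covarianceMatrix, Matrix.of_apply, Finset.mul_sum]
  exact Finset.sum_congr rfl fun i _ => Finset.sum_congr rfl fun j _ => by ring

lemma posSemidef_covarianceMatrix (hY : MemLp Y 2 P) : (covarianceMatrix Y P).PosSemidef := by
  refine .of_dotProduct_mulVec_nonneg (by ext i j; exact covariance_comm _ _) fun v => ?_
  simpa only [covarianceBilin_map_eq_dotProduct_mulVec hY, star_trivial] using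
    covarianceBilin_self_nonneg (μ := P.map Y) (WithLp.toLp 2 v)

lemma covarianceBilin_multivariateGaussian_covarianceMatrix [DecidableEq ι] (hY : MemLp Y 2 P)
    (m : EuclideanSpace ℝ ι) :
    covarianceBilin (multivariateGaussian m (covarianceMatrix Y P)) =
      covarianceBilin (P.map Y) := by
  ext u v
  rw [covarianceBilin_multivariateGaussian (posSemidef_covarianceMatrix hY),
    covarianceBilin_map_eq_dotProduct_mulVec hY]

end CovarianceMatrix

namespace EnsembleAveraging

lemma outputCov_eq_covarianceMatrix {X Par : Type*} [MeasurableSpace Par] {d : ℕ}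
    (N : X → Par → EuclideanSpace ℝ (Fin d)) (DΘ : Measure Par) (x : X) :
    outputCov N DΘ x = covarianceMatrix (N x) DΘ := rfl

lemma sqrt_smul_ensembleAverage_sub {X Par : Type*} {d K : ℕ}
    (N : X → Par → EuclideanSpace ℝ (Fin d)) (θ : Fin K → Par) (x : X)
    (ν : EuclideanSpace ℝ (Fin d)) :
    √(K : ℝ) • (ensembleAverage N θ x - ν) = (√(K : ℝ))⁻¹ • (∑ i, N x (θ i) - (K : ℝ) • ν) := by
  rcases eq_or_ne (K : ℝ) 0 with hK | hK
  · simp only [hK, Real.sqrt_zero, inv_zero, zero_smul]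
  · have hsum : ∑ i, N x (θ i) - (K : ℝ) • ν = (K : ℝ) • (ensembleAverage N θ x - ν) := by
      rw [ensembleAverage, smul_sub, smul_smul, mul_one_div_cancel hK, one_smul]
    rw [hsum, smul_smul, inv_mul_eq_div, Real.div_sqrt]

end EnsembleAveraging

/-- For every `K`, the parameters `Θ K 0, …, Θ K (K - 1)` of `K` independently trained networks are
i.i.d. with law `DΘ` on some probability space `(Ω K, P K)`, which may depend on `K`. -/
theorem mainTheorem1 {X Par : Type*} [MeasurableSpace Par] {d : ℕ}
    (N : X → Par → EuclideanSpace ℝ (Fin d))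
    (DΘ : Measure Par) [IsProbabilityMeasure DΘ]
    {Ω : ℕ → Type*} [∀ K, MeasurableSpace (Ω K)]
    (P : (K : ℕ) → Measure (Ω K)) [∀ K, IsProbabilityMeasure (P K)]
    (Θ : (K : ℕ) → Fin K → Ω K → Par)
    (hlaw : ∀ K i, HasLaw (Θ K i) DΘ (P K))
    (hindep : ∀ K, iIndepFun (Θ K) (P K))
    (x : X) (hN : MemLp (N x) 2 DΘ) :
    TendstoInDistribution
      (fun (K : ℕ) (ω : Ω K) =>
        √(K : ℝ) • (EnsembleAveraging.ensembleAverage N (fun i => Θ K i ω) x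
          - EnsembleAveraging.outputMean N DΘ x))
      atTop
      (id : EuclideanSpace ℝ (Fin d) → EuclideanSpace ℝ (Fin d))
      P
      (multivariateGaussian 0 (EnsembleAveraging.outputCov N DΘ x)) := by
  have hNm : AEMeasurable (N x) DΘ := hN.aemeasurable
  have hmem : MemLp id 2 (DΘ.map (N x)) := (memLp_map_measure_iff (by fun_prop) hNm).2 hN
  have hmean : (DΘ.map (N x))[id] = EnsembleAveraging.outputMean N DΘ x :=
    integral_map hNm (by fun_prop)
  have houtput_law K i : HasLaw (fun ω => N x (Θ K i ω)) (DΘ.map (N x)) (P K) :=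
    HasLaw.fun_comp ⟨hNm, rfl⟩ (hlaw K i)
  have houtput_indep K : iIndepFun (fun i ω => N x (Θ K i ω)) (P K) :=
    (hindep K).comp₀ (fun _ => N x) (fun i => (hlaw K i).aemeasurable)
      fun i => by rwa [(hlaw K i).map_eq]
  simp only [EnsembleAveraging.sqrt_smul_ensembleAverage_sub, ← hmean,
    EnsembleAveraging.outputCov_eq_covarianceMatrix]
  exact tendstoInDistribution_inv_sqrt_smul_sum_sub_of_rows hmem integral_id_multivariateGaussian'
    (covarianceBilin_multivariateGaussian_covarianceMatrix hN 0) .id houtput_law houtput_indep
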